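/- Let $d\le 3$, $\varepsilon>0$, $N\in\mathbb N$, let $x_1,\dots,x_N\in\mathbb R^d$ be distinct points, let $c_1,\dots,c_N$ be nonzero real numbers, and let $\mu=\sum_{j=1}^N c_j\delta_{x_j}$. For $f\in H^2(\mathbb R^d)$ (complex-valued) let $\tilde f$ denote its unique continuous representative. Let $-\Delta+\varepsilon^2\Delta^2+\mu$ denote the lower semibounded self-adjoint operator in $L^2(\mathbb R^d)=L^2(\mathbb R^d,dx;\mathbb C)$ associated with the closed quadratic form with domain $H^2(\mathbb R^d)$ given by $$f\mapsto \varepsilon^2(\Delta f,\Delta f)+(\nabla f,\nabla f)+\int|\tilde f|^2\,d\mu,$$ that is, $f$ lies in the domain of the operator and is mapped to $v$ if and only if $f\in H^2(\mathbb R^d)$, $v\in L^2(\mathbb R^d)$ and the corresponding sesquilinear form at $(f,h)$ equals $(v,h)$ for all $h\in H^2(\mathbb R^d)$. For $\alpha>0$ let $g_{\varepsilon,\alpha}$ be the Green function (convolution kernel of $(-\Delta+\varepsilon^2\Delta^2+\alpha)^{-1}$), $$g_{\varepsilon,\alpha}(x)=(2\pi)^{-d}\int_{\mathbb R^d}\frac{e^{i\langle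 p,x\rangle}}{\varepsilon^2|p|^4+|p|^2+\alpha}\,dp ,\qquad x\in\mathbb R^d .$$ Then for every $\alpha>0$: a) $-\alpha$ is an eigenvalue of $-\Delta+\varepsilon^2\Delta^2+\mu$ if and only if $$\det\left(\frac{\delta_{jk}}{c_k}+g_{\varepsilon,\alpha}(x_j-x_k)\right)_{1\le j,k\le N}=0 .$$ b) The eigenfunctions of $-\Delta+\varepsilon^2\Delta^2+\mu$ for $-\alpha$ are exactly the functions $$\sum_{k=1}^N h_k\,g_{\varepsilon,\alpha}(\cdot-x_k),\qquad 0\ne (h_k)_{1\le k\le N}^T\in\ker\left(\frac{\delta_{jk}}{c_k}+g_{\varepsilon,\alpha}(x_j-x_k)\right)_{1\le j,k\le N}\subset\mathbb C^N .$$ -/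

import Mathlib

open MeasureTheory

namespace FourthOrderSchrodinger

noncomputable section

open TemperedDistribution FourierTransform
open scoped SchwartzMap LineDeriv Laplacian InnerProductSpace ComplexConjugate BoundedContinuousFunction

/-- The Euclidean space `ℝ^d`. -/
abbrev Space (d : ℕ) : Type := EuclideanSpace ℝ (Fin d)

/-- The complex Hilbert space `L²(ℝ^d, dx)`. The inner product `⟪f, h⟫` is antilinear in `f`. -/
abbrev L2 (d : ℕ) : Type := Lp ℂ 2 (volume : Measure (Space d))

/-- The Sobolev space `H²(ℝ^d)`, as a subspace of `L²(ℝ^d)`. -/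
def H2 (d : ℕ) : Submodule ℂ (L2 d) where
  carrier := {f | MemSobolev 2 2 (f : 𝓢'(Space d, ℂ))}
  zero_mem' := by
    have h := memSobolev_fun_zero (Space d) ℂ 2 2
    rwa [← map_zero (Lp.toTemperedDistributionCLM ℂ (volume : Measure (Space d)) 2)] at h
  add_mem' {f g} hf hg := by
    have h := MemSobolev.add hf hg
    simp only [← Lp.toTemperedDistributionCLM_apply, ← map_add] at h
    exact h
  smul_mem' c f hf := by
    have h := MemSobolev.smul c hf
    simp only [← Lp.toTemperedDistributionCLM_apply, ← map_smul] at h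
    exact h

theorem toTemperedDistribution_injective {d : ℕ} {f g : L2 d}
    (h : (f : 𝓢'(Space d, ℂ)) = (g : 𝓢'(Space d, ℂ))) : f = g := by
  have hk := Lp.ker_toTemperedDistributionCLM_eq_bot (F := ℂ)
    (μ := (volume : Measure (Space d))) (p := 2)
  exact LinearMap.ker_eq_bot.mp hk h

theorem exists_laplacian {d : ℕ} (f : H2 d) :
    ∃ u : L2 d, (u : 𝓢'(Space d, ℂ)) = Δ ((f : L2 d) : 𝓢'(Space d, ℂ)) := by
  have h : MemSobolev (2 - 2) 2 (Δ ((f : L2 d) : 𝓢'(Space d, ℂ))) := MemSobolev.laplacian f.2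
  rw [sub_self, memSobolev_zero_iff] at h
  obtain ⟨u, hu⟩ := h
  exact ⟨u, hu.symm⟩

theorem exists_partialDeriv {d : ℕ} (j : Fin d) (f : H2 d) :
    ∃ u : L2 d, (u : 𝓢'(Space d, ℂ)) =
      ∂_{EuclideanSpace.single j (1 : ℝ)} ((f : L2 d) : 𝓢'(Space d, ℂ)) := by
  have h : MemSobolev (2 - 1) 2
      (∂_{EuclideanSpace.single j (1 : ℝ)} ((f : L2 d) : 𝓢'(Space d, ℂ))) :=
    MemSobolev.lineDerivOp f.2
  obtain ⟨u, hu⟩ := memSobolev_zero_iff.mp (h.mono (s' := 0) (by norm_num))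
  exact ⟨u, hu.symm⟩

/-- The distributional Laplacian `Δ : H²(ℝ^d) → L²(ℝ^d)`. -/
def lapl (d : ℕ) : H2 d →ₗ[ℂ] L2 d where
  toFun f := (exists_laplacian f).choose
  map_add' f g := by
    apply toTemperedDistribution_injective
    rw [(exists_laplacian (f + g)).choose_spec, ← Lp.toTemperedDistributionCLM_apply (_ + _),
      map_add, Lp.toTemperedDistributionCLM_apply, Lp.toTemperedDistributionCLM_apply,
      (exists_laplacian f).choose_spec, (exists_laplacian g).choose_spec, Submodule.coe_add,
      ← Lp.toTemperedDistributionCLM_apply (_ + _), map_add]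
    simp only [← laplacianCLM_apply, map_add, Lp.toTemperedDistributionCLM_apply]
  map_smul' c f := by
    apply toTemperedDistribution_injective
    rw [(exists_laplacian (c • f)).choose_spec, ← Lp.toTemperedDistributionCLM_apply (_ • _),
      map_smul, Lp.toTemperedDistributionCLM_apply,
      (exists_laplacian f).choose_spec, Submodule.coe_smul,
      ← Lp.toTemperedDistributionCLM_apply (_ • _), map_smul]
    simp only [← laplacianCLM_apply, map_smul, Lp.toTemperedDistributionCLM_apply, RingHom.id_apply]

/-- The distributional partial derivative `∂_j : H²(ℝ^d) → L²(ℝ^d)`. -/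
def partialDeriv {d : ℕ} (j : Fin d) : H2 d →ₗ[ℂ] L2 d where
  toFun f := (exists_partialDeriv j f).choose
  map_add' f g := by
    apply toTemperedDistribution_injective
    rw [(exists_partialDeriv j (f + g)).choose_spec, ← Lp.toTemperedDistributionCLM_apply (_ + _),
      map_add, Lp.toTemperedDistributionCLM_apply, Lp.toTemperedDistributionCLM_apply,
      (exists_partialDeriv j f).choose_spec, (exists_partialDeriv j g).choose_spec,
      Submodule.coe_add, ← Lp.toTemperedDistributionCLM_apply (_ + _), map_add,
      LineDeriv.lineDerivOp_add]
    rfl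
  map_smul' c f := by
    apply toTemperedDistribution_injective
    rw [(exists_partialDeriv j (c • f)).choose_spec, ← Lp.toTemperedDistributionCLM_apply (_ • _),
      map_smul, Lp.toTemperedDistributionCLM_apply,
      (exists_partialDeriv j f).choose_spec, Submodule.coe_smul,
      ← Lp.toTemperedDistributionCLM_apply (_ • _), map_smul, LineDeriv.lineDerivOp_smul]
    rfl

theorem lapl_spec {d : ℕ} (f : H2 d) :
    ((lapl d f : L2 d) : 𝓢'(Space d, ℂ)) = Δ ((f : L2 d) : 𝓢'(Space d, ℂ)) :=
  (exists_laplacian f).choose_spec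

theorem partialDeriv_spec {d : ℕ} (j : Fin d) (f : H2 d) :
    ((partialDeriv j f : L2 d) : 𝓢'(Space d, ℂ)) =
      ∂_{EuclideanSpace.single j (1 : ℝ)} ((f : L2 d) : 𝓢'(Space d, ℂ)) :=
  (exists_partialDeriv j f).choose_spec

/-- Sobolev embedding: for `d ≤ 3` each `f ∈ H²(ℝ^d)` has a bounded continuous representative. -/
theorem exists_continuous_representative {d : ℕ} (hd : d ≤ 3) (f : H2 d) :
    ∃ g : Space d →ᵇ ℂ, (f : L2 d) =ᵐ[volume] g := by
  have hdim : (Module.finrank ℝ (Space d) : ℝ) < 2 * 2 := by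
    rw [finrank_euclideanSpace_fin]
    have : (d : ℝ) ≤ 3 := by exact_mod_cast hd
    linarith
  obtain ⟨v, hv⟩ := MemSobolev.fourier_memL1 hdim f.2
  refine ⟨Real.Lp.fourierTransformInv v, ?_⟩
  refine ae_eq_of_integral_contDiff_smul_eq
    ((Lp.memLp (f : L2 d)).locallyIntegrable (by norm_num))
    (Real.Lp.fourierTransformInv v).continuous.locallyIntegrable ?_
  intro φ hφ hφc
  have h1 : HasCompactSupport (Complex.ofRealCLM ∘ φ) := hφc.comp_left rfl
  have h2 : ContDiff ℝ (⊤ : ℕ∞) (Complex.ofRealCLM ∘ φ) := by fun_prop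
  set ψ : 𝓢(Space d, ℂ) := h1.toSchwartzMap h2 with hψ
  have h3 : ((f : L2 d) : 𝓢'(Space d, ℂ)) = 𝓕⁻ (v : 𝓢'(Space d, ℂ)) := by
    rw [← hv, fourierInv_fourier_eq]
  have h4 : ((f : L2 d) : 𝓢'(Space d, ℂ)) ψ = (v : 𝓢'(Space d, ℂ)) (𝓕⁻ ψ) := by
    rw [h3, TemperedDistribution.fourierInv_apply]
  rw [Lp.toTemperedDistribution_apply, Lp.toTemperedDistribution_apply] at h4
  have h5 := VectorFourier.integral_fourierIntegral_smul_eq_flip (μ := volume) (ν := volume)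
    (L := -innerₗ (Space d)) (f := (ψ : Space d → ℂ)) (g := (v : Space d → ℂ))
    Real.continuous_fourierChar (by simpa using! continuous_inner.neg) ψ.integrable
    (L1.integrable_coeFn v)
  have h6 : (-innerₗ (Space d)).flip = -innerₗ (Space d) := by
    ext x y
    simp [real_inner_comm]
  rw [h6] at h5
  calc
    ∫ x, φ x • (f : L2 d) x = ∫ x, ψ x • (f : L2 d) x := by simp [hψ]
    _ = ∫ x, (𝓕⁻ ψ) x • v x := h4
    _ = ∫ x, ψ x • (Real.Lp.fourierTransformInv v) x := by
      rw [SchwartzMap.fourierInv_coe]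
      simp only [Real.Lp.fourierTransformInv_apply]
      exact h5
    _ = ∫ x, φ x • (Real.Lp.fourierTransformInv v) x := by simp [hψ]

/-- The continuous representative of `f ∈ H²(ℝ^d)`, `d ≤ 3`. It is unique, since Lebesgue measure
charges all nonempty open sets. -/
def contRep {d : ℕ} (hd : d ≤ 3) (f : H2 d) : Space d →ᵇ ℂ :=
  (exists_continuous_representative hd f).choose

theorem contRep_spec {d : ℕ} (hd : d ≤ 3) (f : H2 d) :
    (f : L2 d) =ᵐ[volume] contRep hd f :=
  (exists_continuous_representative hd f).choose_spec

theorem contRep_eq {d : ℕ} (hd : d ≤ 3) (f : H2 d) {g : Space d → ℂ} (hg : Continuous g)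
    (h : (f : L2 d) =ᵐ[volume] g) : (contRep hd f : Space d → ℂ) = g :=
  (Continuous.ae_eq_iff_eq volume (contRep hd f).continuous hg).mp ((contRep_spec hd f).symm.trans h)

theorem contRep_add {d : ℕ} (hd : d ≤ 3) (f g : H2 d) (x : Space d) :
    contRep hd (f + g) x = contRep hd f x + contRep hd g x := by
  refine congrFun (contRep_eq hd (f + g) (g := fun x => contRep hd f x + contRep hd g x)
    (by fun_prop) ?_) x
  filter_upwards [Lp.coeFn_add (f : L2 d) (g : L2 d), contRep_spec hd f, contRep_spec hd g]
    with y h1 h2 h3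
  rw [Submodule.coe_add, h1, Pi.add_apply, h2, h3]

theorem contRep_smul {d : ℕ} (hd : d ≤ 3) (c : ℂ) (f : H2 d) (x : Space d) :
    contRep hd (c • f) x = c * contRep hd f x := by
  refine congrFun (contRep_eq hd (c • f) (g := fun x => c * contRep hd f x) (by fun_prop) ?_) x
  filter_upwards [Lp.coeFn_smul c (f : L2 d), contRep_spec hd f] with y h1 h2
  rw [Submodule.coe_smul, h1, Pi.smul_apply, h2, smul_eq_mul]

/-- The sesquilinear form of `-Δ + ε²Δ²` with domain `H²(ℝ^d)`:
`ε² (Δf, Δh) + (∇f, ∇h)`. -/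
def freeForm {d : ℕ} (ε : ℝ) (f h : H2 d) : ℂ :=
  (ε : ℂ) ^ 2 * ⟪lapl d f, lapl d h⟫_ℂ + ∑ j, ⟪partialDeriv j f, partialDeriv j h⟫_ℂ

/-- The sesquilinear form with domain `H²(ℝ^d)` obtained from the form of `-Δ + ε²Δ²` by adding
the integral of `conj f * h` (continuous representatives) against the finite signed measure `μ`. -/
def form {d : ℕ} (hd : d ≤ 3) (ε : ℝ) (μ : SignedMeasure (Space d)) (f h : H2 d) : ℂ :=
  freeForm ε f h + ∫ᵛ x, conj (contRep hd f x) * contRep hd h x ∂<•μ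

theorem integrable_conj_mul {d : ℕ} (hd : d ≤ 3) (μ : SignedMeasure (Space d)) (f h : H2 d) :
    μ.Integrable (fun x => conj (contRep hd f x) * contRep hd h x) := by
  have hfin : IsFiniteMeasure μ.variation := by
    rw [← SignedMeasure.totalVariation_eq_variation, SignedMeasure.totalVariation]
    infer_instance
  refine Integrable.of_bound (C := ‖contRep hd f‖ * ‖contRep hd h‖) ?_ ?_
  · exact Continuous.aestronglyMeasurable (by fun_prop)
  · filter_upwards with x
    rw [norm_mul, RCLike.norm_conj]
    gcongr <;> exact BoundedContinuousFunction.norm_coe_le_norm _ _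

theorem form_add_left {d : ℕ} (hd : d ≤ 3) (ε : ℝ) (μ : SignedMeasure (Space d)) (f g h : H2 d) :
    form hd ε μ (f + g) h = form hd ε μ f h + form hd ε μ g h := by
  have h1 : freeForm ε (f + g) h = freeForm ε f h + freeForm ε g h := by
    simp only [freeForm, map_add, inner_add_left, Finset.sum_add_distrib]
    ring
  have h2 := VectorMeasure.integral_fun_add
    (B := (ContinuousLinearMap.lsmul ℝ ℝ (E := ℂ)).flip)
    (integrable_conj_mul hd μ f h) (integrable_conj_mul hd μ g h)
  simp only [form, h1, contRep_add, map_add, add_mul]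
  rw [h2]
  ring

theorem form_smul_left {d : ℕ} (hd : d ≤ 3) (ε : ℝ) (μ : SignedMeasure (Space d)) (c : ℂ)
    (f h : H2 d) : form hd ε μ (c • f) h = conj c * form hd ε μ f h := by
  have h1 : freeForm ε (c • f) h = conj c * freeForm ε f h := by
    simp only [freeForm, map_smul, inner_smul_left, mul_add, Finset.mul_sum]
    ring
  have h2 : ∫ᵛ x, conj c • (conj (contRep hd f x) * contRep hd h x) ∂<•μ =
      conj c • ∫ᵛ x, conj (contRep hd f x) * contRep hd h x ∂<•μ := by
    simp only [VectorMeasure.integral_eq_setToFun]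
    refine setToFun_smul _ (fun a s z => ?_) (conj c) _
    simp only [transpose_eq_cbmApplyMeasure, cbmApplyMeasure_apply,
      ContinuousLinearMap.flip_apply, ContinuousLinearMap.lsmul_apply]
    exact smul_comm _ _ _
  simp only [smul_eq_mul] at h2
  simp only [form, h1, contRep_smul, map_mul, mul_assoc]
  rw [h2]
  ring

/-- The graph of the operator associated with the form (in the sense of Kato's representation
theorem): `(f, v)` such that `f ∈ H²(ℝ^d)` and `form f h = (v, h)` for all `h ∈ H²(ℝ^d)`. -/
def opGraph {d : ℕ} (hd : d ≤ 3) (ε : ℝ) (μ : SignedMeasure (Space d)) :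
    Submodule ℂ (L2 d × L2 d) where
  carrier := {p | ∃ f : H2 d, (f : L2 d) = p.1 ∧
    ∀ h : H2 d, form hd ε μ f h = ⟪p.2, (h : L2 d)⟫_ℂ}
  zero_mem' := by
    refine ⟨0, rfl, fun h => ?_⟩
    have h1 := form_smul_left hd ε μ 0 0 h
    simpa using h1
  add_mem' := by
    rintro ⟨a, v⟩ ⟨b, w⟩ ⟨f, hf, hf'⟩ ⟨g, hg, hg'⟩
    refine ⟨f + g, ?_, fun h => ?_⟩
    · simp only at hf hg
      simp [hf, hg]
    · rw [form_add_left, hf', hg', Prod.snd_add, inner_add_left]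
  smul_mem' := by
    rintro c ⟨a, v⟩ ⟨f, hf, hf'⟩
    refine ⟨c • f, ?_, fun h => ?_⟩
    · simp only at hf
      simp [hf]
    · rw [form_smul_left, hf', Prod.smul_snd, inner_smul_left]

theorem dense_H2 (d : ℕ) : Dense (H2 d : Set (L2 d)) := by
  have h := SchwartzMap.denseRange_toLpCLM (E := Space d) (F := ℂ) (p := 2)
    (μ := (volume : Measure (Space d))) ENNReal.ofNat_ne_top
  refine Dense.mono ?_ h
  rintro _ ⟨φ, rfl⟩
  change MemSobolev 2 2 ((φ.toLp 2 volume : L2 d) : 𝓢'(Space d, ℂ))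
  rw [Lp.toTemperedDistribution_toLp_eq]
  exact SchwartzMap.memSobolev φ

theorem opGraph_singleValued {d : ℕ} (hd : d ≤ 3) (ε : ℝ) (μ : SignedMeasure (Space d))
    (p : L2 d × L2 d) (hp : p ∈ opGraph hd ε μ) (hp1 : p.1 = 0) : p.2 = 0 := by
  obtain ⟨f, hf, hf'⟩ := hp
  have hf0 : f = 0 := by
    apply Subtype.ext
    rw [hf, hp1]
    rfl
  refine (dense_H2 d).eq_zero_of_inner_left (𝕜 := ℂ) fun u hu => ?_
  have h1 := form_smul_left hd ε μ 0 0 ⟨u, hu⟩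
  have h2 := hf' ⟨u, hu⟩
  rw [hf0] at h2
  rw [← h2]
  simpa using h1

/-- The operator `-Δ + ε²Δ² + μ` in `L²(ℝ^d)` associated with the form, `d ≤ 3`. -/
def schrodingerOp {d : ℕ} (hd : d ≤ 3) (ε : ℝ) (μ : SignedMeasure (Space d)) :
    L2 d →ₗ.[ℂ] L2 d :=
  (opGraph hd ε μ).toLinearPMap

theorem schrodingerOp_graph {d : ℕ} (hd : d ≤ 3) (ε : ℝ) (μ : SignedMeasure (Space d)) :
    (schrodingerOp hd ε μ).graph = opGraph hd ε μ :=
  Submodule.toLinearPMap_graph_eq _ (opGraph_singleValued hd ε μ)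

/-- `f` is an eigenfunction of the operator `A` for the eigenvalue `lam`. -/
def IsEigenfunction {d : ℕ} (A : L2 d →ₗ.[ℂ] L2 d) (lam : ℂ) (f : L2 d) : Prop :=
  f ≠ 0 ∧ ∃ hf : f ∈ A.domain, A ⟨f, hf⟩ = lam • f

/-- `lam` is an eigenvalue of the operator `A`. -/
def IsEigenvalue {d : ℕ} (A : L2 d →ₗ.[ℂ] L2 d) (lam : ℂ) : Prop :=
  ∃ f : L2 d, IsEigenfunction A lam f

/-- The Green function of `-Δ + ε²Δ² + α`, i.e. the function whose convolution operator is
`(-Δ + ε²Δ² + α)⁻¹`: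
`g(x) = (2π)^(-d) ∫ exp(i⟨p, x⟩) / (ε²|p|⁴ + |p|² + α) dp`. -/
def green {d : ℕ} (ε α : ℝ) (x : Space d) : ℂ :=
  ((2 * Real.pi : ℝ) ^ d : ℂ)⁻¹ *
    ∫ p : Space d, Complex.exp (Complex.I * (⟪p, x⟫_ℝ : ℝ)) /
      ((ε ^ 2 * ‖p‖ ^ 4 + ‖p‖ ^ 2 + α : ℝ) : ℂ)

/-- The point measure `∑ⱼ cⱼ δ_{xⱼ}`. -/
def pointMeasure {d N : ℕ} (c : Fin N → ℝ) (x : Fin N → Space d) : SignedMeasure (Space d) :=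
  ∑ j, c j • VectorMeasure.dirac (x j) (1 : ℝ)

/-- The matrix `(δ_{jk}/c_k + g(x_j - x_k))_{jk}`. -/
def greenMatrix {d N : ℕ} (ε α : ℝ) (c : Fin N → ℝ) (x : Fin N → Space d) :
    Matrix (Fin N) (Fin N) ℂ :=
  Matrix.of fun j k => (if j = k then 1 / (c k : ℂ) else 0) + green ε α (x j - x k)

end

end FourthOrderSchrodinger

namespace FourthOrderSchrodinger

noncomputable section

open TemperedDistribution FourierTransform Filter
open scoped SchwartzMap LineDeriv Laplacian InnerProductSpace ComplexConjugate
  BoundedContinuousFunction ENNReal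

/-! ### Multipliers and Fourier inversion for `Lp` functions -/

/-! Moving `α` to the form side, `f` is an eigenfunction for `-α` iff `f ≠ 0` and the form of `-Δ +
ε²Δ² + α` at `(f, h)` equals `-∑ c_k conj(f(x_k)) h(x_k)` for every `h` in `H²`. By Plancherel this
shifted form is integration against a symbol that dominates a multiple of `(1 + |ξ|²)²`. Since `d ≤
3`, the Green function therefore lies in `H²` and represents point evaluation:
`shiftedForm_greenH2`.

As the shifted form is positive definite, the eigenvalue equation becomes `f = ∑ h_k g(· - x_k)`
with `h_k = -c_k f(x_k)` (`forall_shiftedForm_eq_sum_iff`). Evaluating at `x_j` and dividing by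
`c_j` gives exactly the kernel equation of the matrix. Conversely a kernel vector satisfies `h_k =
-c_k f(x_k)` for the sum it defines, and it vanishes if that sum does
(`isEigenfunction_pointMeasure_iff_exists_ker`). The determinant criterion follows. -/

/-- Locally integrable functions are determined by testing against smooth compactly supported
functions. The exponents may differ so that an `L¹` and an `L²` representative of one distribution
can be compared. -/
theorem ae_eq_mul_of_smulLeftCLM_eq {d : ℕ} {p q : ℝ≥0∞} [Fact (1 ≤ p)] [Fact (1 ≤ q)]
    {g : Space d → ℂ} (hg : g.HasTemperateGrowth)
    {u : Lp ℂ p (volume : Measure (Space d))} {v : Lp ℂ q (volume : Measure (Space d))}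
    (h : smulLeftCLM ℂ g (u : 𝓢'(Space d, ℂ)) = (v : 𝓢'(Space d, ℂ))) :
    v =ᵐ[volume] fun x => g x * u x := by
  have hu : LocallyIntegrable u volume := (Lp.memLp u).locallyIntegrable Fact.out
  have hv : LocallyIntegrable v volume := (Lp.memLp v).locallyIntegrable Fact.out
  have hgu : LocallyIntegrable (fun x => g x * u x) volume := by
    rw [← locallyIntegrableOn_univ] at hu ⊢
    exact hu.continuousOn_mul hg.1.continuous.continuousOn isOpen_univ.isLocallyClosed
  refine ae_eq_of_integral_contDiff_smul_eq hv hgu fun φ hφ hφc => ?_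
  have h1 : HasCompactSupport (Complex.ofRealCLM ∘ φ) := hφc.comp_left rfl
  have h2 : ContDiff ℝ (⊤ : ℕ∞) (Complex.ofRealCLM ∘ φ) := by fun_prop
  have h3 := DFunLike.congr_fun h (h1.toSchwartzMap h2)
  rw [smulLeftCLM_apply_apply, Lp.toTemperedDistribution_apply, Lp.toTemperedDistribution_apply]
    at h3
  simp only [SchwartzMap.smulLeftCLM_apply_apply hg] at h3
  calc ∫ x, φ x • v x = ∫ x, (h1.toSchwartzMap h2) x • v x := by simp
    _ = ∫ x, φ x • (g x * u x) := by
      rw [← h3]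
      refine integral_congr_ae (ae_of_all _ fun x => ?_)
      simp
      ring

theorem smulLeftCLM_eq_of_ae_eq_mul {d : ℕ} {p q : ℝ≥0∞} [Fact (1 ≤ p)] [Fact (1 ≤ q)]
    {g : Space d → ℂ} (hg : g.HasTemperateGrowth)
    {u : Lp ℂ p (volume : Measure (Space d))} {v : Lp ℂ q (volume : Measure (Space d))}
    (h : v =ᵐ[volume] fun x => g x * u x) :
    smulLeftCLM ℂ g (u : 𝓢'(Space d, ℂ)) = (v : 𝓢'(Space d, ℂ)) := by
  ext φ
  rw [smulLeftCLM_apply_apply, Lp.toTemperedDistribution_apply, Lp.toTemperedDistribution_apply]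
  refine integral_congr_ae ?_
  filter_upwards [h] with x hx
  rw [SchwartzMap.smulLeftCLM_apply_apply hg, hx]
  simp only [smul_eq_mul]
  ring

theorem continuous_fourierInv {d : ℕ} {w : Space d → ℂ} (hw : Integrable w) :
    Continuous (𝓕⁻ w) := by
  rw [← Real.Lp.fourierTransformInv_toLp (memLp_one_iff_integrable.mpr hw)]
  exact (Real.Lp.fourierTransformInv _).continuous

/-- Links the abstract `L²` inverse transform to the integral formula: Fubini moves the transform
onto a test function. -/
theorem fourierInv_ae_eq {d : ℕ} (w : L2 d) (hw : Integrable w) :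
    (𝓕⁻ w : L2 d) =ᵐ[volume] 𝓕⁻ (w : Space d → ℂ) := by
  refine ae_eq_of_integral_contDiff_smul_eq
    ((Lp.memLp (𝓕⁻ w : L2 d)).locallyIntegrable (by norm_num))
    (continuous_fourierInv hw).locallyIntegrable ?_
  intro φ hφ hφc
  have h1 : HasCompactSupport (Complex.ofRealCLM ∘ φ) := hφc.comp_left rfl
  have h2 : ContDiff ℝ (⊤ : ℕ∞) (Complex.ofRealCLM ∘ φ) := by fun_prop
  set ψ : 𝓢(Space d, ℂ) := h1.toSchwartzMap h2 with hψ
  have h4 := DFunLike.congr_fun (Lp.fourierInv_toTemperedDistribution_eq w) ψ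
  rw [TemperedDistribution.fourierInv_apply, Lp.toTemperedDistribution_apply,
    Lp.toTemperedDistribution_apply] at h4
  have h5 := VectorFourier.integral_fourierIntegral_smul_eq_flip (μ := volume) (ν := volume)
    (L := -innerₗ (Space d)) (f := (ψ : Space d → ℂ)) (g := (w : Space d → ℂ))
    Real.continuous_fourierChar (by simpa using! continuous_inner.neg) ψ.integrable hw
  -- The kernel is symmetric, so exchanging the two variables changes nothing.
  have h6 : (-innerₗ (Space d)).flip = -innerₗ (Space d) := by
    ext x y
    simp [real_inner_comm]
  rw [h6] at h5
  have h7 : ∫ x, φ x • (𝓕⁻ w : L2 d) x = ∫ x, ψ x • (𝓕⁻ w : L2 d) x := by simp [hψ]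
  rw [h7, ← h4, SchwartzMap.fourierInv_coe]
  refine h5.trans (integral_congr_ae (ae_of_all _ fun x => ?_))
  simp only [hψ, HasCompactSupport.toSchwartzMap_toFun, Function.comp_apply,
    Complex.ofRealCLM_apply, Complex.coe_smul]
  rfl

/-! ### The Sobolev space on the Fourier side -/

theorem fourier_lapl {d : ℕ} (f : H2 d) :
    (𝓕 (lapl d f) : L2 d) =ᵐ[volume]
      fun ξ => (-(2 * Real.pi * ‖ξ‖) ^ 2 : ℝ) * (𝓕 (f : L2 d) : L2 d) ξ := by
  have h : (fun ξ : Space d => ((-(2 * Real.pi * ‖ξ‖) ^ 2 : ℝ) : ℂ)) =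
      (-(2 * Real.pi : ℂ) ^ 2) • fun ξ : Space d => Complex.ofReal (‖ξ‖ ^ 2) := by
    ext ξ
    simp
    ring
  refine ae_eq_mul_of_smulLeftCLM_eq (by rw [h]; fun_prop) ?_
  rw [← Lp.fourier_toTemperedDistribution_eq, ← Lp.fourier_toTemperedDistribution_eq, lapl_spec,
    laplacian_eq_fourierMultiplierCLM, fourierMultiplierCLM_apply, h,
    smulLeftCLM_smul (by fun_prop), ← Complex.coe_smul, fourier_smul, fourier_fourierInv_eq]
  push_cast
  rfl

theorem fourier_partialDeriv {d : ℕ} (j : Fin d) (f : H2 d) :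
    (𝓕 (partialDeriv j f) : L2 d) =ᵐ[volume]
      fun ξ => (2 * Real.pi * Complex.I * (ξ j : ℝ)) * (𝓕 (f : L2 d) : L2 d) ξ := by
  have h : (fun ξ : Space d => (2 * Real.pi * Complex.I * (ξ j : ℝ) : ℂ)) =
      (2 * Real.pi * Complex.I : ℂ) •
        fun ξ : Space d => Complex.ofReal (inner ℝ ξ (EuclideanSpace.single j (1 : ℝ))) := by
    ext ξ
    simp [EuclideanSpace.inner_single_right]
  refine ae_eq_mul_of_smulLeftCLM_eq (by rw [h]; fun_prop) ?_
  rw [← Lp.fourier_toTemperedDistribution_eq, ← Lp.fourier_toTemperedDistribution_eq,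
    partialDeriv_spec, fourier_lineDerivOp_eq, h, smulLeftCLM_smul (by fun_prop)]
  rfl

theorem integrable_fourier {d : ℕ} (hd : d ≤ 3) (f : H2 d) :
    Integrable (𝓕 (f : L2 d) : L2 d) := by
  have hdim : (Module.finrank ℝ (Space d) : ℝ) < 2 * 2 := by
    rw [finrank_euclideanSpace_fin]
    have : (d : ℝ) ≤ 3 := by exact_mod_cast hd
    linarith
  obtain ⟨v, hv⟩ := MemSobolev.fourier_memL1 hdim f.2
  rw [Lp.fourier_toTemperedDistribution_eq] at hv
  -- The constant multiplier `1` identifies the `L¹` and `L²` representatives of the transform.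
  have h := ae_eq_mul_of_smulLeftCLM_eq (g := fun _ => (1 : ℂ)) (by fun_prop)
    (u := (𝓕 (f : L2 d) : L2 d)) (v := v) (by rw [smulLeftCLM_const, one_smul, hv])
  simp only [one_mul] at h
  exact (L1.integrable_coeFn v).congr h

theorem contRep_eq_fourierInv {d : ℕ} (hd : d ≤ 3) (f : H2 d) :
    (contRep hd f : Space d → ℂ) = 𝓕⁻ ((𝓕 (f : L2 d) : L2 d) : Space d → ℂ) := by
  have hi := integrable_fourier hd f
  refine contRep_eq hd f (continuous_fourierInv hi) ?_
  have := fourierInv_ae_eq _ hi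
  rwa [fourierInv_fourier_eq] at this

theorem exists_H2_fourier_ae_eq {d : ℕ} {w : Space d → ℂ} (hw : MemLp w 2)
    (hw' : MemLp (fun ξ => ((1 + ‖ξ‖ ^ 2 : ℝ) : ℂ) * w ξ) 2) :
    ∃ f : H2 d, (𝓕 (f : L2 d) : L2 d) =ᵐ[volume] w := by
  refine ⟨⟨𝓕⁻ (hw.toLp w), ?_⟩, ?_⟩
  · refine memSobolev_iff_exists_smulLeftCLM_fourier.mpr ⟨hw'.toLp _, ?_⟩
    rw [Lp.fourier_toTemperedDistribution_eq, fourier_fourierInv_eq]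
    refine smulLeftCLM_eq_of_ae_eq_mul (by fun_prop) ?_
    filter_upwards [hw.coeFn_toLp, hw'.coeFn_toLp] with ξ h1 h2
    rw [h1, h2]
    simp
  · simp only [fourier_fourierInv_eq]
    exact hw.coeFn_toLp

/-! ### The form of `-Δ + ε²Δ² + α` -/

/-- The Fourier symbol of `-Δ + ε²Δ² + α`, for the Fourier transform with kernel
`exp(-2πi⟨x, ξ⟩)`. -/
def symbol {d : ℕ} (ε α : ℝ) (ξ : Space d) : ℝ :=
  ε ^ 2 * (2 * Real.pi * ‖ξ‖) ^ 4 + (2 * Real.pi * ‖ξ‖) ^ 2 + α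

theorem symbol_pos {d : ℕ} (ε : ℝ) {α : ℝ} (hα : 0 < α) (ξ : Space d) : 0 < symbol ε α ξ := by
  unfold symbol
  positivity

theorem continuous_symbol {d : ℕ} (ε α : ℝ) : Continuous (symbol (d := d) ε α) := by
  unfold symbol
  fun_prop

/-- The sesquilinear form of `-Δ + ε²Δ² + α` with domain `H²(ℝ^d)`. -/
def shiftedForm {d : ℕ} (ε α : ℝ) (f h : H2 d) : ℂ :=
  freeForm ε f h + α * ⟪(f : L2 d), (h : L2 d)⟫_ℂ

/-- Plancherel for a multiplier `a`. Integrability is included because the terms of the form are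
later summed under one integral. -/
theorem inner_eq_integral_of_fourier_ae_eq {d : ℕ} {a : Space d → ℂ} {f h F H : L2 d}
    (hF : (𝓕 F : L2 d) =ᵐ[volume] fun ξ => a ξ * (𝓕 f : L2 d) ξ)
    (hH : (𝓕 H : L2 d) =ᵐ[volume] fun ξ => a ξ * (𝓕 h : L2 d) ξ) :
    Integrable (fun ξ => conj (a ξ) * a ξ * (conj ((𝓕 f : L2 d) ξ) * (𝓕 h : L2 d) ξ)) ∧
      ⟪F, H⟫_ℂ = ∫ ξ, conj (a ξ) * a ξ * (conj ((𝓕 f : L2 d) ξ) * (𝓕 h : L2 d) ξ) := by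
  have key : (fun ξ => ⟪(𝓕 F : L2 d) ξ, (𝓕 H : L2 d) ξ⟫_ℂ) =ᵐ[volume]
      fun ξ => conj (a ξ) * a ξ * (conj ((𝓕 f : L2 d) ξ) * (𝓕 h : L2 d) ξ) := by
    filter_upwards [hF, hH] with ξ h1 h2
    rw [RCLike.inner_apply', h1, h2, map_mul]
    ring
  refine ⟨(L2.integrable_inner (𝕜 := ℂ) _ _).congr key, ?_⟩
  rw [← Lp.inner_fourier_eq, L2.inner_def]
  exact integral_congr_ae key

theorem shiftedForm_eq_integral {d : ℕ} (ε α : ℝ) (f h : H2 d) :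
    shiftedForm ε α f h = ∫ ξ, (symbol ε α ξ : ℂ) *
      (conj ((𝓕 (f : L2 d) : L2 d) ξ) * (𝓕 (h : L2 d) : L2 d) ξ) := by
  obtain ⟨i1, e1⟩ := inner_eq_integral_of_fourier_ae_eq (fourier_lapl f) (fourier_lapl h)
  have hp := fun j => inner_eq_integral_of_fourier_ae_eq (fourier_partialDeriv j f)
    (fourier_partialDeriv j h)
  obtain ⟨i3, e3⟩ := inner_eq_integral_of_fourier_ae_eq (a := fun _ => 1)
    (F := (f : L2 d)) (f := (f : L2 d)) (H := (h : L2 d)) (h := (h : L2 d))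
    (by simp) (by simp)
  rw [shiftedForm, freeForm, e1, e3, Finset.sum_congr rfl fun j _ => (hp j).2,
    ← integral_finsetSum _ fun j _ => (hp j).1, ← integral_const_mul, ← integral_const_mul,
    ← integral_add (i1.const_mul _) (integrable_finsetSum _ fun j _ => (hp j).1),
    ← integral_add ((i1.const_mul _).fun_add (integrable_finsetSum _ fun j _ => (hp j).1))
      (i3.const_mul _)]
  refine integral_congr_ae (ae_of_all _ fun ξ => ?_)
  have hn : ((‖ξ‖ : ℝ) : ℂ) ^ 2 = ∑ j, ((ξ j : ℝ) : ℂ) ^ 2 := by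
    have := EuclideanSpace.real_norm_sq_eq ξ
    exact_mod_cast this
  have hs : ∀ j, conj (2 * Real.pi * Complex.I * (ξ j : ℝ) : ℂ) *
      (2 * Real.pi * Complex.I * (ξ j : ℝ)) = (2 * Real.pi : ℂ) ^ 2 * ((ξ j : ℝ) : ℂ) ^ 2 := by
    intro j
    simp only [map_mul, Complex.conj_I, Complex.conj_ofReal, map_ofNat]
    linear_combination (-(2 * Real.pi : ℂ) ^ 2 * ((ξ j : ℝ) : ℂ) ^ 2) * Complex.I_sq
  simp only [hs, ← Finset.sum_mul, ← Finset.mul_sum, ← hn, Complex.conj_ofReal, symbol]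
  push_cast
  simp only [map_one]
  ring

/-- All terms of the quadratic form are nonnegative, and `α > 0` makes the `L²` term control `f`. -/
theorem eq_zero_of_shiftedForm_self_eq_zero {d : ℕ} (ε : ℝ) {α : ℝ} (hα : 0 < α) {f : H2 d}
    (h : shiftedForm ε α f f = 0) : f = 0 := by
  simp only [shiftedForm, freeForm, inner_self_eq_norm_sq_to_K] at h
  have h' : ε ^ 2 * ‖lapl d f‖ ^ 2 + ∑ j, ‖partialDeriv j f‖ ^ 2 + α * ‖(f : L2 d)‖ ^ 2 = 0 := by
    apply Complex.ofReal_injective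
    push_cast
    exact h
  have h1 : 0 ≤ ∑ j, ‖partialDeriv j f‖ ^ 2 := Finset.sum_nonneg fun j _ => sq_nonneg _
  have h2 : 0 ≤ ε ^ 2 * ‖lapl d f‖ ^ 2 := by positivity
  have h3 : 0 ≤ α * ‖(f : L2 d)‖ ^ 2 := by positivity
  have h4 : α * ‖(f : L2 d)‖ ^ 2 = 0 := by linarith
  have h5 : ‖(f : L2 d)‖ = 0 := by
    rcases mul_eq_zero.mp h4 with h | h
    · exact absurd h hα.ne'
    · exact pow_eq_zero_iff (two_ne_zero) |>.mp h
  exact Subtype.ext (norm_eq_zero.mp h5)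

theorem shiftedForm_add_left {d : ℕ} (ε α : ℝ) (f g h : H2 d) :
    shiftedForm ε α (f + g) h = shiftedForm ε α f h + shiftedForm ε α g h := by
  simp only [shiftedForm, freeForm, map_add, inner_add_left, Finset.sum_add_distrib,
    Submodule.coe_add]
  ring

theorem shiftedForm_smul_left {d : ℕ} (ε α : ℝ) (c : ℂ) (f h : H2 d) :
    shiftedForm ε α (c • f) h = conj c * shiftedForm ε α f h := by
  simp only [shiftedForm, freeForm, map_smul, inner_smul_left, mul_add, Finset.mul_sum,
    Submodule.coe_smul]
  ring

theorem shiftedForm_sum_smul_left {d : ℕ} {ι : Type*} (ε α : ℝ) (s : Finset ι) (a : ι → ℂ)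
    (f : ι → H2 d) (h : H2 d) :
    shiftedForm ε α (∑ k ∈ s, a k • f k) h = ∑ k ∈ s, conj (a k) * shiftedForm ε α (f k) h := by
  classical
  induction s using Finset.induction_on with
  | empty => simpa using shiftedForm_smul_left ε α 0 0 h
  | insert k s hk ih =>
    rw [Finset.sum_insert hk, Finset.sum_insert hk, shiftedForm_add_left, shiftedForm_smul_left,
      ih]

theorem contRep_sum_smul {d : ℕ} (hd : d ≤ 3) {ι : Type*} (s : Finset ι) (a : ι → ℂ)
    (f : ι → H2 d) (y : Space d) :
    contRep hd (∑ k ∈ s, a k • f k) y = ∑ k ∈ s, a k * contRep hd (f k) y := by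
  classical
  induction s using Finset.induction_on with
  | empty => simpa using contRep_smul hd 0 0 y
  | insert k s hk ih =>
    rw [Finset.sum_insert hk, Finset.sum_insert hk, contRep_add, contRep_smul, ih]

/-! ### The Green function -/

/-- The symbol dominates both `α` and `ε²|ξ|⁴`, while `(1 + t)² ≤ 2 + 2t²` with `t = |ξ|²`. -/
theorem one_add_norm_sq_sq_le_symbol {d : ℕ} {ε α : ℝ} (hε : 0 < ε) (hα : 0 < α) (ξ : Space d) :
    (1 + ‖ξ‖ ^ 2) ^ 2 ≤ (2 / α + 2 / ε ^ 2) * symbol ε α ξ := by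
  have hπ : (1 : ℝ) ≤ 2 * Real.pi := by linarith [Real.pi_gt_three]
  have h1 : ‖ξ‖ ^ 4 ≤ (2 * Real.pi * ‖ξ‖) ^ 4 := by
    gcongr
    exact le_mul_of_one_le_left (norm_nonneg _) hπ
  have h2 : α ≤ symbol ε α ξ := by
    unfold symbol
    have : 0 ≤ ε ^ 2 * (2 * Real.pi * ‖ξ‖) ^ 4 + (2 * Real.pi * ‖ξ‖) ^ 2 := by positivity
    linarith
  have h3 : ε ^ 2 * ‖ξ‖ ^ 4 ≤ symbol ε α ξ := by
    unfold symbol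
    have : 0 ≤ (2 * Real.pi * ‖ξ‖) ^ 2 := by positivity
    nlinarith [mul_le_mul_of_nonneg_left h1 (sq_nonneg ε)]
  calc (1 + ‖ξ‖ ^ 2) ^ 2 ≤ 2 / α * α + 2 / ε ^ 2 * (ε ^ 2 * ‖ξ‖ ^ 4) := by
        have e1 : 2 / α * α = 2 := by field_simp
        have e2 : 2 / ε ^ 2 * (ε ^ 2 * ‖ξ‖ ^ 4) = 2 * ‖ξ‖ ^ 4 := by field_simp
        rw [e1, e2]
        nlinarith [sq_nonneg (1 - ‖ξ‖ ^ 2)]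
    _ ≤ 2 / α * symbol ε α ξ + 2 / ε ^ 2 * symbol ε α ξ := by gcongr
    _ = _ := by ring

theorem integrable_inv_one_add_norm_sq_sq {d : ℕ} (hd : d ≤ 3) :
    Integrable (fun ξ : Space d => ((1 + ‖ξ‖ ^ 2) ^ 2)⁻¹) := by
  have hdim : (Module.finrank ℝ (Space d) : ℝ) < 4 := by
    rw [finrank_euclideanSpace_fin]
    have : (d : ℝ) ≤ 3 := by exact_mod_cast hd
    linarith
  refine (integrable_rpow_neg_one_add_norm_sq hdim).congr (ae_of_all _ fun ξ => ?_)
  have : (-4 / 2 : ℝ) = -(2 : ℕ) := by norm_num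
  simp only [this]
  rw [Real.rpow_neg (by positivity), Real.rpow_natCast]

/-- The Fourier transform of the Green function with pole `y`. -/
def greenFourier {d : ℕ} (ε α : ℝ) (y ξ : Space d) : ℂ :=
  Complex.exp (-(2 * Real.pi * ⟪ξ, y⟫_ℝ : ℝ) * Complex.I) / (symbol ε α ξ : ℂ)

theorem norm_greenFourier {d : ℕ} (ε : ℝ) {α : ℝ} (hα : 0 < α) (y ξ : Space d) :
    ‖greenFourier ε α y ξ‖ = (symbol ε α ξ)⁻¹ := by
  rw [greenFourier, norm_div, ← Complex.ofReal_neg, Complex.norm_exp_ofReal_mul_I,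
    Complex.norm_real, Real.norm_of_nonneg (symbol_pos ε hα ξ).le, one_div]

theorem continuous_greenFourier {d : ℕ} (ε : ℝ) {α : ℝ} (hα : 0 < α) (y : Space d) :
    Continuous (greenFourier ε α y) := by
  unfold greenFourier
  refine Continuous.div ?_ (Complex.continuous_ofReal.comp (continuous_symbol ε α))
    fun ξ => Complex.ofReal_ne_zero.mpr (symbol_pos ε hα ξ).ne'
  fun_prop

theorem inv_symbol_le {d : ℕ} {ε α : ℝ} (hε : 0 < ε) (hα : 0 < α) (ξ : Space d) :
    (symbol ε α ξ)⁻¹ ≤ (2 / α + 2 / ε ^ 2) * ((1 + ‖ξ‖ ^ 2) ^ 2)⁻¹ := by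
  have h := one_add_norm_sq_sq_le_symbol hε hα ξ
  rw [← div_eq_mul_inv, le_div_iff₀ (by positivity), inv_mul_le_iff₀ (symbol_pos ε hα ξ), mul_comm]
  exact h

/-- The product is bounded by a multiple of `(1 + |ξ|²)⁻¹`, whose square is integrable because `d <
4`. This is the `H²` condition for the Green function. -/
theorem memLp_mul_greenFourier {d : ℕ} (hd : d ≤ 3) {ε α : ℝ} (hε : 0 < ε) (hα : 0 < α)
    (y : Space d) :
    MemLp (fun ξ => ((1 + ‖ξ‖ ^ 2 : ℝ) : ℂ) * greenFourier ε α y ξ) 2 := by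
  have hc : Continuous fun ξ => ((1 + ‖ξ‖ ^ 2 : ℝ) : ℂ) * greenFourier ε α y ξ :=
    Continuous.mul (by fun_prop) (continuous_greenFourier ε hα y)
  rw [memLp_two_iff_integrable_sq_norm hc.aestronglyMeasurable]
  refine ((integrable_inv_one_add_norm_sq_sq hd).const_mul ((2 / α + 2 / ε ^ 2) ^ 2)).mono'
    (hc.norm.pow 2).aestronglyMeasurable (ae_of_all _ fun ξ => ?_)
  rw [norm_mul, norm_greenFourier ε hα, Complex.norm_real, Real.norm_of_nonneg (by positivity),
    Real.norm_of_nonneg (by positivity)]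
  have hs := symbol_pos ε hα ξ
  calc ((1 + ‖ξ‖ ^ 2) * (symbol ε α ξ)⁻¹) ^ 2
      ≤ ((1 + ‖ξ‖ ^ 2) * ((2 / α + 2 / ε ^ 2) * ((1 + ‖ξ‖ ^ 2) ^ 2)⁻¹)) ^ 2 := by
        gcongr
        exact inv_symbol_le hε hα ξ
    _ = _ := by field_simp

theorem memLp_greenFourier {d : ℕ} (hd : d ≤ 3) {ε α : ℝ} (hε : 0 < ε) (hα : 0 < α)
    (y : Space d) : MemLp (greenFourier ε α y) 2 := by
  refine (memLp_mul_greenFourier hd hε hα y).mono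
    (continuous_greenFourier ε hα y).aestronglyMeasurable (ae_of_all _ fun ξ => ?_)
  rw [norm_mul, Complex.norm_real, Real.norm_of_nonneg (by positivity)]
  exact le_mul_of_one_le_left (norm_nonneg _) (le_add_of_nonneg_right (sq_nonneg _))

/-- Substituting `p = 2πξ` turns the unitary normalization into that of `green`; the Jacobian is the
prefactor `(2π)^(-d)`. -/
theorem fourierInv_greenFourier {d : ℕ} (ε α : ℝ) (y x : Space d) :
    𝓕⁻ (greenFourier ε α y) x = green ε α (x - y) := by
  have h := Measure.integral_comp_smul (volume : Measure (Space d))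
    (fun p => Complex.exp (Complex.I * (⟪p, x - y⟫_ℝ : ℝ)) /
      ((ε ^ 2 * ‖p‖ ^ 4 + ‖p‖ ^ 2 + α : ℝ) : ℂ)) (2 * Real.pi)
  rw [finrank_euclideanSpace_fin, abs_of_pos (by positivity)] at h
  rw [Real.fourierInv_eq', green]
  refine Eq.trans (integral_congr_ae (ae_of_all _ fun ξ => ?_)) (h.trans ?_)
  · simp only [greenFourier, symbol, smul_eq_mul, norm_smul, real_inner_smul_left,
      Real.norm_of_nonneg (show 0 ≤ 2 * Real.pi by positivity), inner_sub_right]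
    rw [← mul_div_assoc, ← Complex.exp_add]
    congr 2
    push_cast
    ring
  · rw [Complex.real_smul]
    push_cast
    rfl

/-- The Green function with pole `y`, as an element of `H²(ℝ^d)`. -/
def greenH2 {d : ℕ} (hd : d ≤ 3) {ε α : ℝ} (hε : 0 < ε) (hα : 0 < α) (y : Space d) : H2 d :=
  (exists_H2_fourier_ae_eq (memLp_greenFourier hd hε hα y)
    (memLp_mul_greenFourier hd hε hα y)).choose

theorem fourier_greenH2 {d : ℕ} (hd : d ≤ 3) {ε α : ℝ} (hε : 0 < ε) (hα : 0 < α) (y : Space d) :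
    (𝓕 (greenH2 hd hε hα y : L2 d) : L2 d) =ᵐ[volume] greenFourier ε α y :=
  (exists_H2_fourier_ae_eq (memLp_greenFourier hd hε hα y)
    (memLp_mul_greenFourier hd hε hα y)).choose_spec

theorem contRep_greenH2 {d : ℕ} (hd : d ≤ 3) {ε α : ℝ} (hε : 0 < ε) (hα : 0 < α)
    (y x : Space d) : contRep hd (greenH2 hd hε hα y) x = green ε α (x - y) := by
  rw [contRep_eq_fourierInv, ← fourierInv_greenFourier]
  exact Real.fourierInv_congr_ae (fourier_greenH2 hd hε hα y) x

/-- The reproducing property of the Green function. -/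
theorem shiftedForm_greenH2 {d : ℕ} (hd : d ≤ 3) {ε α : ℝ} (hε : 0 < ε) (hα : 0 < α)
    (y : Space d) (h : H2 d) :
    shiftedForm ε α (greenH2 hd hε hα y) h = contRep hd h y := by
  rw [shiftedForm_eq_integral, contRep_eq_fourierInv, Real.fourierInv_eq']
  refine integral_congr_ae ?_
  filter_upwards [fourier_greenH2 hd hε hα y] with ξ hξ
  have hs : (symbol ε α ξ : ℂ) ≠ 0 := Complex.ofReal_ne_zero.mpr (symbol_pos ε hα ξ).ne'
  -- Conjugation turns the phase into the inverse Fourier kernel at `y`, and the symbol cancels its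
  -- reciprocal.
  rw [hξ, greenFourier, map_div₀, ← Complex.exp_conj, Complex.conj_ofReal, smul_eq_mul, map_mul,
    map_neg, Complex.conj_I, Complex.conj_ofReal, neg_mul_neg]
  field_simp

theorem forall_shiftedForm_eq_sum_iff {d N : ℕ} (hd : d ≤ 3) {ε α : ℝ} (hε : 0 < ε) (hα : 0 < α)
    (x : Fin N → Space d) (a : Fin N → ℂ) (f : H2 d) :
    (∀ h : H2 d, shiftedForm ε α f h = ∑ k, conj (a k) * contRep hd h (x k)) ↔
      f = ∑ k, a k • greenH2 hd hε hα (x k) := by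
  have key : ∀ h, shiftedForm ε α (∑ k, a k • greenH2 hd hε hα (x k)) h =
      ∑ k, conj (a k) * contRep hd h (x k) := fun h => by
    simp only [shiftedForm_sum_smul_left, shiftedForm_greenH2]
  constructor
  · intro hf
    rw [← sub_eq_zero]
    apply eq_zero_of_shiftedForm_self_eq_zero ε hα
    -- With `G` the sum and `w = f - G`, expand the form at `(w + G, w)`. Since `f` and `G` give the
    -- same value against `w`, the form at `(w, w)` vanishes.
    have h1 := shiftedForm_add_left ε α (f - ∑ k, a k • greenH2 hd hε hα (x k))
      (∑ k, a k • greenH2 hd hε hα (x k)) (f - ∑ k, a k • greenH2 hd hε hα (x k))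
    rw [sub_add_cancel, hf, key] at h1
    exact right_eq_add.mp h1
  · rintro rfl
    exact key

/-! ### Point interactions -/

theorem integral_pointMeasure {d N : ℕ} (c : Fin N → ℝ) (x : Fin N → Space d)
    (g : Space d → ℂ) : ∫ᵛ y, g y ∂<•(pointMeasure c x) = ∑ j, (c j : ℂ) * g (x j) := by
  have hi : ∀ j, (VectorMeasure.dirac (x j) (1 : ℝ)).Integrable g := fun j => by
    rw [VectorMeasure.Integrable, VectorMeasure.variation_dirac]
    exact (integrable_dirac (by simp)).smul_measure (by simp)
  rw [pointMeasure, VectorMeasure.integral_finsetSum_vectorMeasure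
    fun j _ => (hi j).smul_vectorMeasure _]
  refine Finset.sum_congr rfl fun j _ => ?_
  rw [VectorMeasure.integral_smul_vectorMeasure, VectorMeasure.integral_dirac]
  simp

/-- The Green representation with coefficients `-c_k F(x_k)`; it is implicit, as `F` also occurs on
the right through its values at the points. -/
theorem isEigenfunction_pointMeasure_iff {d N : ℕ} (hd : d ≤ 3) {ε α : ℝ} (hε : 0 < ε)
    (hα : 0 < α) (c : Fin N → ℝ) (x : Fin N → Space d) (f : L2 d) :
    IsEigenfunction (schrodingerOp hd ε (pointMeasure c x)) (-α : ℂ) f ↔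
      f ≠ 0 ∧ ∃ F : H2 d, (F : L2 d) = f ∧
        F = ∑ k, (-(c k : ℂ) * contRep hd F (x k)) • greenH2 hd hε hα (x k) := by
  have h1 : IsEigenfunction (schrodingerOp hd ε (pointMeasure c x)) (-α : ℂ) f ↔
      f ≠ 0 ∧ (f, (-α : ℂ) • f) ∈ opGraph hd ε (pointMeasure c x) := by
    rw [IsEigenfunction, ← schrodingerOp_graph, LinearPMap.mem_graph_iff]
    refine and_congr_right fun _ => ⟨?_, ?_⟩
    · rintro ⟨hf, h⟩
      exact ⟨⟨f, hf⟩, rfl, h⟩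
    · rintro ⟨⟨g, hg⟩, rfl, h⟩
      exact ⟨hg, h⟩
  rw [h1]
  refine and_congr_right fun _ => exists_congr fun F => and_congr_right fun hF => ?_
  simp only at hF
  rw [← forall_shiftedForm_eq_sum_iff hd hε hα]
  refine forall_congr' fun h => ?_
  rw [form, integral_pointMeasure, shiftedForm, inner_smul_left, ← hF, map_neg, Complex.conj_ofReal,
    ← sub_eq_zero, ← sub_eq_zero (a := freeForm ε F h + _)]
  simp only [map_mul, map_neg, Complex.conj_ofReal, neg_mul, Finset.sum_neg_distrib, mul_assoc]
  refine Eq.congr ?_ rfl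
  ring

theorem isEigenfunction_pointMeasure_iff_exists_ker {d N : ℕ} (hd : d ≤ 3) {ε α : ℝ} (hε : 0 < ε)
    (hα : 0 < α) {c : Fin N → ℝ} (hc : ∀ j, c j ≠ 0) (x : Fin N → Space d) (f : L2 d) :
    IsEigenfunction (schrodingerOp hd ε (pointMeasure c x)) (-α : ℂ) f ↔
      ∃ h : Fin N → ℂ, h ≠ 0 ∧ (greenMatrix ε α c x).mulVec h = 0 ∧
        f = ((∑ k, h k • greenH2 hd hε hα (x k) : H2 d) : L2 d) := by
  -- Multiplying row `j` by `c_j ≠ 0` turns the kernel equation into consistency of `h_j` with the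
  -- value at `x_j` of the function built from `h`.
  have hker : ∀ h : Fin N → ℂ, (greenMatrix ε α c x).mulVec h = 0 ↔
      ∀ j, h j = -(c j : ℂ) * contRep hd (∑ k, h k • greenH2 hd hε hα (x k)) (x j) := by
    intro h
    rw [funext_iff]
    refine forall_congr' fun j => ?_
    have hcj : (c j : ℂ) ≠ 0 := Complex.ofReal_ne_zero.mpr (hc j)
    simp only [contRep_sum_smul, contRep_greenH2, Matrix.mulVec, dotProduct, greenMatrix,
      Matrix.of_apply, add_mul, Finset.sum_add_distrib, ite_mul, zero_mul, Finset.sum_ite_eq,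
      Finset.mem_univ, if_true, Pi.zero_apply, mul_comm (green _ _ _)]
    rw [← mul_right_inj' hcj, mul_zero, mul_add, ← mul_assoc, mul_one_div_cancel hcj, one_mul,
      add_eq_zero_iff_eq_neg, neg_mul]
  rw [isEigenfunction_pointMeasure_iff hd hε hα]
  constructor
  · rintro ⟨hf, F, rfl, hF⟩
    refine ⟨fun k => -(c k : ℂ) * contRep hd F (x k), ?_, ?_, ?_⟩
    · intro h0
      apply hf
      rw [hF]
      simp [funext_iff.mp h0]
    · rw [hker, ← hF]
      exact fun j => rfl
    · rw [← hF]
  · rintro ⟨h, h0, hM, rfl⟩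
    rw [hker] at hM
    -- If the function were zero, so would be its values at the points, and `hM` would force `h =
    -- 0`.
    refine ⟨fun hz => h0 (funext fun j => ?_), _, rfl, ?_⟩
    · have hz' : (∑ k, h k • greenH2 hd hε hα (x k) : H2 d) = 0 := Subtype.ext hz
      have := contRep_smul hd 0 0 (x j)
      rw [zero_smul, zero_mul] at this
      rw [hM j, hz', this, mul_zero, Pi.zero_apply]
    · conv_lhs => rw [Finset.sum_congr rfl fun k _ => by rw [hM k]]

/-- The explicit sum is the continuous representative of the `H²` element, so both sides name the
same `L²` class. -/
theorem eq_sum_greenH2_iff {d N : ℕ} (hd : d ≤ 3) {ε α : ℝ} (hε : 0 < ε) (hα : 0 < α)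
    (x : Fin N → Space d) (h : Fin N → ℂ) (f : L2 d) :
    f = ((∑ k, h k • greenH2 hd hε hα (x k) : H2 d) : L2 d) ↔
      f =ᵐ[volume] fun y => ∑ k, h k * green ε α (y - x k) := by
  have h1 := contRep_spec hd (∑ k, h k • greenH2 hd hε hα (x k))
  have h2 : (contRep hd (∑ k, h k • greenH2 hd hε hα (x k)) : Space d → ℂ) =
      fun y => ∑ k, h k * green ε α (y - x k) := by
    ext y
    simp only [contRep_sum_smul, contRep_greenH2]
  rw [h2] at h1
  exact ⟨fun hf => hf ▸ h1, fun hf => Lp.ext (hf.trans h1.symm)⟩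

end

end FourthOrderSchrodinger

theorem theorem8 {d : ℕ} (hd : d ≤ 3) (ε : ℝ) (hε : 0 < ε) {N : ℕ} (c : Fin N → ℝ)
    (hc : ∀ j, c j ≠ 0) (x : Fin N → FourthOrderSchrodinger.Space d)
    (hx : Function.Injective x) (α : ℝ) (hα : 0 < α) :
    (FourthOrderSchrodinger.IsEigenvalue
        (FourthOrderSchrodinger.schrodingerOp hd ε (FourthOrderSchrodinger.pointMeasure c x))
        (-α : ℂ) ↔
      (FourthOrderSchrodinger.greenMatrix ε α c x).det = 0) ∧
    ∀ f : FourthOrderSchrodinger.L2 d,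
      FourthOrderSchrodinger.IsEigenfunction
          (FourthOrderSchrodinger.schrodingerOp hd ε (FourthOrderSchrodinger.pointMeasure c x))
          (-α : ℂ) f ↔
        ∃ h : Fin N → ℂ, h ≠ 0 ∧ (FourthOrderSchrodinger.greenMatrix ε α c x).mulVec h = 0 ∧
          ⇑f =ᵐ[volume] fun y => ∑ k, h k * FourthOrderSchrodinger.green ε α (y - x k) := by
  open FourthOrderSchrodinger in
  have key : ∀ f : L2 d,
      IsEigenfunction (schrodingerOp hd ε (pointMeasure c x)) (-α : ℂ) f ↔
        ∃ h : Fin N → ℂ, h ≠ 0 ∧ (greenMatrix ε α c x).mulVec h = 0 ∧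
          ⇑f =ᵐ[volume] fun y => ∑ k, h k * green ε α (y - x k) := fun f => by
    rw [isEigenfunction_pointMeasure_iff_exists_ker hd hε hα hc]
    simp only [eq_sum_greenH2_iff]
  refine ⟨?_, key⟩
  rw [← Matrix.exists_mulVec_eq_zero_iff]
  constructor
  · rintro ⟨f, hf⟩
    obtain ⟨h, h0, hM, -⟩ := (key f).mp hf
    exact ⟨h, h0, hM⟩
  · rintro ⟨h, h0, hM⟩
    exact ⟨_, (FourthOrderSchrodinger.isEigenfunction_pointMeasure_iff_exists_ker hd hε hα hc x
      _).mpr ⟨h, h0, hM, rfl⟩⟩
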